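/- Let $\ell\ge 1$, let $n_0,\dots,n_\ell$ and $m$ be natural numbers, and write $c=n_0$, $d=n_\ell$. Let $Y\in\mathbb{R}^{c\times m}$ and $X\in\mathbb{R}^{d\times m}$, and suppose that the smallest eigenvalue $\lambda:=\lambda_{\min}(XX^\top)$ is positive (this forces $1\le d\le m$). For weights $W=(W_1,\dots,W_\ell)$, $W_i\in\mathbb{R}^{n_{i-1}\times n_i}$, let $$f(W)=\|Y-W_1W_2\cdots W_\ell X\|_{\rm F}^2 ,\qquad f^*=\inf_W f(W),$$ where the infimum is over all weights. Let $\nabla^2 f(W)$ be the Hessian of $f$ with respect to the vector of all entries of all $W_i$. Let $\|\cdot\|_2$ be the spectral norm and $\|\cdot\|_{\rm F}$ the Frobenius norm, and put $$\bar H_0=4\ell^2\left(\big(2d^{\frac{\ell-1}{2}}\big)^{\frac{2\ell-2}{\ell}}\Big(\frac1\lambda\Big)^{\frac{2\ell-2}{2\ell}}\|Y\|_{\rm F}^{\frac{2\ell-2}{\ell}}\|X\|_2^2+\big(2d^{\frac{\ell-1}{2}}\big)^{\frac{\ell-2}{\ell}}\Big(\frac1\lambda\Big)^{\frac{\ell-2}{2\ell}}\|Y\|_{\rm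 F}^{\frac{\ell-2}{\ell}}\|X\|_2\right),$$ $$H_1=4\ell^2\left(\big(2d^{\frac{\ell-1}{2}}\big)^{\frac{2\ell-2}{\ell}}\Big(\frac1\lambda\Big)^{\frac{2\ell-2}{2\ell}}\|X\|_2^2+\big(2d^{\frac{\ell-1}{2}}\big)^{\frac{\ell-2}{\ell}}\Big(\frac1\lambda\Big)^{\frac{\ell-2}{2\ell}}\|X\|_2+\big(2d^{\frac{\ell-1}{2}}\big)^{\frac{\ell-2}{\ell}}\Big(\frac1\lambda\Big)^{\frac{\ell-2}{2\ell}}\|Y\|_{\rm F}^{\frac{\ell-2}{\ell}}\|X\|_2\right),$$ $$H_0=2\bar H_0+H_1(1+f^*),$$ where $0^0=1$ and, in the case $\ell=1$, $Y=0$, the power $\|Y\|_{\rm F}^{-1}$ is read as $0$. Then for all weights $W$ that are strongly balanced, i.e. $W_i^\top W_i=W_{i+1}W_{i+1}^\top$ for all $1\le i\le \ell-1$, $$\|\nabla^2 f(W)\|_2\le H_0+H_1\,(f(W)-f^*).$$ -/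

import Mathlib

open scoped Matrix

noncomputable section

namespace DeepLinear

/-- The Frobenius norm of a real matrix. -/
def frobNorm {a b : ℕ} (A : Matrix (Fin a) (Fin b) ℝ) : ℝ :=
  letI := Matrix.frobeniusNormedAddCommGroup (m := Fin a) (n := Fin b) (α := ℝ)
  ‖A‖

/-- The spectral norm of a real matrix: the operator norm with respect to Euclidean norms. -/
def specNorm {a b : ℕ} (A : Matrix (Fin a) (Fin b) ℝ) : ℝ :=
  letI := Matrix.instL2OpNormedAddCommGroup (m := Fin a) (n := Fin b) (𝕜 := ℝ)
  ‖A‖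

theorem isHermitian_gram {a b : ℕ} (X : Matrix (Fin a) (Fin b) ℝ) : (X * Xᵀ).IsHermitian := by
  rw [← Matrix.conjTranspose_eq_transpose_of_trivial]
  exact Matrix.isHermitian_mul_conjTranspose_self X

/-- The smallest eigenvalue of the symmetric matrix `X * Xᵀ`. -/
def lambdaMinGram {a b : ℕ} (X : Matrix (Fin a) (Fin b) ℝ) : ℝ :=
  ⨅ i, (isHermitian_gram X).eigenvalues i

/-- The parameter space of a linear network with `ℓ` layers and widths `n 0, …, n ℓ`: all entries
of all weight matrices, collected in one vector, with the Euclidean norm. The widths `n k` with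
`k > ℓ` are not used. -/
abbrev Params (ℓ : ℕ) (n : ℕ → ℕ) : Type :=
  EuclideanSpace ℝ (Σ i : Fin ℓ, Fin (n i) × Fin (n (i + 1)))

variable {ℓ m : ℕ} {n : ℕ → ℕ}

/-- The weight matrix of layer `i`. Layers are numbered from `0`, so this is the matrix which is
usually written `W_{i+1}`; it has size `n i × n (i + 1)`. -/
def weight (W : Params ℓ n) (i : Fin ℓ) : Matrix (Fin (n i)) (Fin (n (i + 1))) ℝ :=
  Matrix.of fun a b => W ⟨i, (a, b)⟩

/-- The product of the first `k` weight matrices, in order. -/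
def layerProd (W : Params ℓ n) : (k : ℕ) → k ≤ ℓ → Matrix (Fin (n 0)) (Fin (n k)) ℝ
  | 0, _ => 1
  | k + 1, h => layerProd W k (Nat.le_of_succ_le h) * weight W ⟨k, h⟩

/-- The loss `‖Y - W₁ W₂ ⋯ W_ℓ X‖_F ^ 2` as a function of the weights. -/
def loss (Y : Matrix (Fin (n 0)) (Fin m) ℝ) (X : Matrix (Fin (n ℓ)) (Fin m) ℝ)
    (W : Params ℓ n) : ℝ :=
  frobNorm (Y - layerProd W ℓ le_rfl * X) ^ 2

/-- Strong balancedness: `W_iᵀ W_i = W_{i+1} W_{i+1}ᵀ` for any two consecutive layers. -/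
def StronglyBalanced (W : Params ℓ n) : Prop :=
  ∀ (i : ℕ) (h : i + 1 < ℓ),
    (weight W ⟨i, Nat.lt_of_succ_lt h⟩)ᵀ * weight W ⟨i, Nat.lt_of_succ_lt h⟩ =
      weight W ⟨i + 1, h⟩ * (weight W ⟨i + 1, h⟩)ᵀ

/-- The Hessian of `f` at `w`, as a linear operator: the derivative of the gradient. Its operator
norm is the spectral norm of the matrix of second partial derivatives. -/
def hessian {ι : Type} [Fintype ι] (f : EuclideanSpace ℝ ι → ℝ) (w : EuclideanSpace ℝ ι) :
    EuclideanSpace ℝ ι →L[ℝ] EuclideanSpace ℝ ι :=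
  fderiv ℝ (gradient f) w

/-- The constant `H̄₀`; `lam` stands for the smallest eigenvalue of `X Xᵀ`, `x` for the spectral
norm of `X` and `y` for the Frobenius norm of `Y`. -/
def constH0bar (ℓ d : ℕ) (lam x y : ℝ) : ℝ :=
  4 * (ℓ : ℝ) ^ 2 *
    ((2 * (d : ℝ) ^ (((ℓ : ℝ) - 1) / 2)) ^ ((2 * (ℓ : ℝ) - 2) / ℓ)
        * (1 / lam) ^ ((2 * (ℓ : ℝ) - 2) / (2 * ℓ)) * y ^ ((2 * (ℓ : ℝ) - 2) / ℓ) * x ^ 2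
      + (2 * (d : ℝ) ^ (((ℓ : ℝ) - 1) / 2)) ^ (((ℓ : ℝ) - 2) / ℓ)
        * (1 / lam) ^ (((ℓ : ℝ) - 2) / (2 * ℓ)) * y ^ (((ℓ : ℝ) - 2) / ℓ) * x)

/-- The constant `H₁`. -/
def constH1 (ℓ d : ℕ) (lam x y : ℝ) : ℝ :=
  4 * (ℓ : ℝ) ^ 2 *
    ((2 * (d : ℝ) ^ (((ℓ : ℝ) - 1) / 2)) ^ ((2 * (ℓ : ℝ) - 2) / ℓ)
        * (1 / lam) ^ ((2 * (ℓ : ℝ) - 2) / (2 * ℓ)) * x ^ 2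
      + (2 * (d : ℝ) ^ (((ℓ : ℝ) - 1) / 2)) ^ (((ℓ : ℝ) - 2) / ℓ)
        * (1 / lam) ^ (((ℓ : ℝ) - 2) / (2 * ℓ)) * x
      + (2 * (d : ℝ) ^ (((ℓ : ℝ) - 1) / 2)) ^ (((ℓ : ℝ) - 2) / ℓ)
        * (1 / lam) ^ (((ℓ : ℝ) - 2) / (2 * ℓ)) * y ^ (((ℓ : ℝ) - 2) / ℓ) * x)

/-- The constant `H₀ = 2 H̄₀ + H₁ (1 + f*)`. -/
def constH0 (ℓ d : ℕ) (lam x y fstar : ℝ) : ℝ :=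
  2 * constH0bar ℓ d lam x y + constH1 ℓ d lam x y * (1 + fstar)

end DeepLinear

end

/-! Let P = W₁⋯W_ℓ, R = Y − PX and g = ‖R‖_F = √f(W). The Hessian form is 2⟨DP[U]X, DP[V]X⟩ − 2⟨R,
D²P[U,V]X⟩. If every layer has spectral norm at most s, this gives ‖∇²f‖ ≤ 2ℓ(s^(2ℓ−2)‖X‖² +
s^(ℓ−2)‖X‖g), without the second term when ℓ = 1 (`norm_hessian_loss_le`).

Balancedness controls s by the loss: all layers share one spectral norm s, and PᵀP = (W_ℓᵀW_ℓ)^ℓ, so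
s^ℓ ≤ ‖P‖₂ (`StronglyBalanced.pow_le_specNorm_layerProd`). Hence √λ s^ℓ ≤ √λ‖P‖_F ≤ ‖PX‖_F ≤ ‖Y‖_F +
g.

Powers of s thus become powers of ‖Y‖_F and g. The exponents of g that arise lie in [0, 2], so these
powers of g are at most 1 + g² = 1 + f(W) (`hessian_bound_le_const`). -/

open scoped Matrix

noncomputable section

namespace DeepLinear

/-! ### Frobenius and spectral norms, and the smallest eigenvalue of a Gram matrix. -/

section Norms

variable {a b c : ℕ}

theorem frobNorm_sq (A : Matrix (Fin a) (Fin b) ℝ) : frobNorm A ^ 2 = ∑ i, ∑ j, A i j ^ 2 := by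
  unfold frobNorm
  rw [Matrix.frobenius_norm_def, ← Real.sqrt_eq_rpow, Real.sq_sqrt (by positivity)]
  simp

theorem frobNorm_nonneg (A : Matrix (Fin a) (Fin b) ℝ) : 0 ≤ frobNorm A :=
  letI := Matrix.frobeniusNormedAddCommGroup (m := Fin a) (n := Fin b) (α := ℝ)
  norm_nonneg A

theorem frobNorm_add_le (A B : Matrix (Fin a) (Fin b) ℝ) :
    frobNorm (A + B) ≤ frobNorm A + frobNorm B :=
  letI := Matrix.frobeniusNormedAddCommGroup (m := Fin a) (n := Fin b) (α := ℝ)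
  norm_add_le A B

theorem frobNorm_sub_le (A B : Matrix (Fin a) (Fin b) ℝ) :
    frobNorm (A - B) ≤ frobNorm A + frobNorm B :=
  letI := Matrix.frobeniusNormedAddCommGroup (m := Fin a) (n := Fin b) (α := ℝ)
  norm_sub_le A B

theorem frobNorm_zero : frobNorm (0 : Matrix (Fin a) (Fin b) ℝ) = 0 :=
  letI := Matrix.frobeniusNormedAddCommGroup (m := Fin a) (n := Fin b) (α := ℝ)
  norm_zero

theorem frobNorm_transpose (A : Matrix (Fin a) (Fin b) ℝ) : frobNorm Aᵀ = frobNorm A :=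
  Matrix.frobenius_norm_transpose A

theorem specNorm_nonneg (A : Matrix (Fin a) (Fin b) ℝ) : 0 ≤ specNorm A :=
  letI := Matrix.instL2OpNormedAddCommGroup (m := Fin a) (n := Fin b) (𝕜 := ℝ)
  norm_nonneg A

theorem specNorm_transpose (A : Matrix (Fin a) (Fin b) ℝ) : specNorm Aᵀ = specNorm A := by
  rw [← Matrix.conjTranspose_eq_transpose_of_trivial]
  exact Matrix.l2_opNorm_conjTranspose A

theorem specNorm_mul_le (A : Matrix (Fin a) (Fin b) ℝ) (B : Matrix (Fin b) (Fin c) ℝ) :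
    specNorm (A * B) ≤ specNorm A * specNorm B :=
  Matrix.l2_opNorm_mul A B

theorem specNorm_transpose_mul_self (A : Matrix (Fin a) (Fin b) ℝ) :
    specNorm (Aᵀ * A) = specNorm A ^ 2 := by
  rw [← Matrix.conjTranspose_eq_transpose_of_trivial, sq]
  exact Matrix.l2_opNorm_conjTranspose_mul_self A

/-- The norm t satisfies t = t². Equality with 1 fails for the empty matrix. -/
theorem specNorm_one_le : specNorm (1 : Matrix (Fin a) (Fin a) ℝ) ≤ 1 := by
  have h : specNorm (1 : Matrix (Fin a) (Fin a) ℝ) = specNorm (1 : Matrix (Fin a) (Fin a) ℝ) ^ 2 := by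
    rw [← specNorm_transpose_mul_self, Matrix.transpose_one, one_mul]
  nlinarith [specNorm_nonneg (1 : Matrix (Fin a) (Fin a) ℝ)]

theorem sum_mulVec_sq_le (A : Matrix (Fin a) (Fin b) ℝ) (v : Fin b → ℝ) :
    ∑ i, (A *ᵥ v) i ^ 2 ≤ specNorm A ^ 2 * ∑ j, v j ^ 2 := by
  have h := Matrix.l2_opNorm_mulVec A (WithLp.toLp 2 v)
  have h2 := pow_le_pow_left₀ (norm_nonneg _) h 2
  rw [mul_pow, EuclideanSpace.norm_sq_eq, EuclideanSpace.norm_sq_eq] at h2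
  simp only [Real.norm_eq_abs, sq_abs] at h2
  exact h2

theorem specNorm_le_of_sum_mulVec_sq_le (A : Matrix (Fin a) (Fin b) ℝ) {C : ℝ} (hC : 0 ≤ C)
    (h : ∀ v : Fin b → ℝ, ∑ i, (A *ᵥ v) i ^ 2 ≤ C ^ 2 * ∑ j, v j ^ 2) : specNorm A ≤ C := by
  refine ContinuousLinearMap.opNorm_le_bound _ hC fun x => ?_
  refine (sq_le_sq₀ (norm_nonneg _) (by positivity)).mp ?_
  rw [mul_pow, EuclideanSpace.norm_sq_eq, EuclideanSpace.norm_sq_eq]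
  simpa using h x.ofLp

theorem frobNorm_mul_le (A : Matrix (Fin a) (Fin b) ℝ) (B : Matrix (Fin b) (Fin c) ℝ) :
    frobNorm (A * B) ≤ specNorm A * frobNorm B := by
  refine (sq_le_sq₀ (frobNorm_nonneg _)
    (mul_nonneg (specNorm_nonneg _) (frobNorm_nonneg _))).mp ?_
  rw [mul_pow, frobNorm_sq, frobNorm_sq, Finset.sum_comm,
    Finset.sum_comm (f := fun i j => B i j ^ 2), Finset.mul_sum]
  exact Finset.sum_le_sum fun j _ => sum_mulVec_sq_le A fun i => B i j

theorem frobNorm_mul_le' (A : Matrix (Fin a) (Fin b) ℝ) (B : Matrix (Fin b) (Fin c) ℝ) :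
    frobNorm (A * B) ≤ frobNorm A * specNorm B := by
  rw [← frobNorm_transpose, Matrix.transpose_mul, mul_comm, ← frobNorm_transpose A,
    ← specNorm_transpose B]
  exact frobNorm_mul_le _ _

theorem specNorm_le_frobNorm (A : Matrix (Fin a) (Fin b) ℝ) : specNorm A ≤ frobNorm A := by
  refine specNorm_le_of_sum_mulVec_sq_le A (frobNorm_nonneg A) fun v => ?_
  rw [frobNorm_sq, Finset.sum_mul]
  exact Finset.sum_le_sum fun i _ => Finset.sum_mul_sq_le_sq_mul_sq Finset.univ (A i) v

theorem abs_sum_mul_le_frobNorm (A B : Matrix (Fin a) (Fin b) ℝ) :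
    |∑ i, ∑ j, A i j * B i j| ≤ frobNorm A * frobNorm B := by
  refine abs_le_of_sq_le_sq ?_ (mul_nonneg (frobNorm_nonneg _) (frobNorm_nonneg _))
  rw [mul_pow, frobNorm_sq, frobNorm_sq]
  simp only [← Fintype.sum_prod_type']
  exact Finset.sum_mul_sq_le_sq_mul_sq _ (fun p : Fin a × Fin b => A p.1 p.2)
    fun p => B p.1 p.2

-- The C*-identity gives ‖A^N‖ = ‖A‖^N when N is a power of two. Writing N = (k + 1) + (r + 1),
-- submultiplicativity bounds ‖A^N‖ by ‖A^(k+1)‖‖A‖^(r+1), and the last factor cancels.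
open scoped Matrix.Norms.L2Operator in
theorem pow_specNorm_le_specNorm_pow {A : Matrix (Fin a) (Fin a) ℝ} (hA : Aᵀ = A) (k : ℕ) :
    specNorm A ^ (k + 1) ≤ specNorm (A ^ (k + 1)) := by
  change ‖A‖ ^ (k + 1) ≤ ‖A ^ (k + 1)‖
  have hs : IsSelfAdjoint A := by
    rw [IsSelfAdjoint, Matrix.star_eq_conjTranspose,
      Matrix.conjTranspose_eq_transpose_of_trivial, hA]
  rcases (norm_nonneg A).eq_or_lt with h0 | h0
  · rw [← h0, zero_pow k.succ_ne_zero]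
    exact norm_nonneg _
  obtain ⟨r, hr⟩ := Nat.exists_eq_add_of_lt (Nat.lt_two_pow_self (n := k + 1))
  have h := hs.norm_pow_two_pow (k + 1)
  rw [hr, add_assoc, pow_add, pow_add ‖A‖] at h
  refine le_of_mul_le_mul_right ?_ (pow_pos h0 (r + 1))
  rw [← h]
  exact (norm_mul_le _ _).trans
    (mul_le_mul_of_nonneg_left (norm_pow_le' A r.succ_pos) (norm_nonneg _))

/-- By the spectral theorem XXᵀ − λI = U diag(eigenvalues − λ) Uᴴ, which is positive semidefinite.
-/
theorem lambdaMinGram_mul_sum_sq_le (X : Matrix (Fin a) (Fin b) ℝ) (v : Fin a → ℝ) :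
    lambdaMinGram X * ∑ i, v i ^ 2 ≤ ∑ j, (v ᵥ* X) j ^ 2 := by
  set hG := isHermitian_gram X
  have hv : ∑ i, v i ^ 2 = v ⬝ᵥ v := by simp [dotProduct, sq]
  have hX : ∑ j, (v ᵥ* X) j ^ 2 = v ⬝ᵥ ((X * Xᵀ) *ᵥ v) := by
    rw [← Matrix.mulVec_mulVec, Matrix.dotProduct_mulVec, Matrix.mulVec_transpose]
    simp [dotProduct, sq]
  have hle : ∀ i, lambdaMinGram X ≤ hG.eigenvalues i := fun i =>
    ciInf_le (Set.finite_range _).bddBelow i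
  set U : Matrix (Fin a) (Fin a) ℝ := hG.eigenvectorUnitary.1
  have hU : U * Uᴴ = 1 := Unitary.mul_star_self_of_mem hG.eigenvectorUnitary.2
  have hspec : X * Xᵀ = U * Matrix.diagonal hG.eigenvalues * Uᴴ := by
    conv_lhs => rw [hG.spectral_theorem, Unitary.conjStarAlgAut_apply]
    rfl
  have hd : (Matrix.diagonal fun i => hG.eigenvalues i - lambdaMinGram X).PosSemidef :=
    Matrix.PosSemidef.diagonal fun i => sub_nonneg.2 (hle i)
  have hp := (hd.mul_mul_conjTranspose_same U).dotProduct_mulVec_nonneg v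
  have he : U * (Matrix.diagonal fun i => hG.eigenvalues i - lambdaMinGram X) * Uᴴ
      = X * Xᵀ - lambdaMinGram X • 1 := by
    rw [← Matrix.diagonal_sub, ← Matrix.smul_one_eq_diagonal, Matrix.mul_sub, Matrix.sub_mul,
      Matrix.mul_smul, Matrix.smul_mul, mul_one, hU]
    exact congrArg (· - lambdaMinGram X • (1 : Matrix (Fin a) (Fin a) ℝ)) hspec.symm
  rw [he, Matrix.sub_mulVec, dotProduct_sub, Matrix.smul_mulVec, Matrix.one_mulVec,
    dotProduct_smul, smul_eq_mul, star_trivial] at hp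
  rw [hv, hX]
  linarith

theorem sqrt_lambdaMinGram_mul_frobNorm_le (A : Matrix (Fin c) (Fin a) ℝ)
    (X : Matrix (Fin a) (Fin b) ℝ) :
    √(lambdaMinGram X) * frobNorm A ≤ frobNorm (A * X) := by
  rcases le_or_gt (lambdaMinGram X) 0 with h | h
  · rw [Real.sqrt_eq_zero_of_nonpos h, zero_mul]
    exact frobNorm_nonneg _
  refine (sq_le_sq₀ (mul_nonneg (Real.sqrt_nonneg _) (frobNorm_nonneg _))
    (frobNorm_nonneg _)).mp ?_
  rw [mul_pow, Real.sq_sqrt h.le, frobNorm_sq, frobNorm_sq, Finset.mul_sum]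
  exact Finset.sum_le_sum fun i _ => lambdaMinGram_mul_sum_sq_le X (A i)

end Norms

/-! ### First and second derivatives of the loss along lines. -/

section Derivatives

variable {ℓ m : ℕ} {n : ℕ → ℕ}

/-- The first derivative of `layerProd` at `W` in direction `U`. -/
def dLayerProd (W U : Params ℓ n) : (k : ℕ) → k ≤ ℓ → Matrix (Fin (n 0)) (Fin (n k)) ℝ
  | 0, _ => 0
  | k + 1, h => dLayerProd W U k (Nat.le_of_succ_le h) * weight W ⟨k, h⟩
      + layerProd W k (Nat.le_of_succ_le h) * weight U ⟨k, h⟩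

/-- The second derivative of `layerProd` at `W` in directions `U` and `V`. -/
def d2LayerProd (W U V : Params ℓ n) : (k : ℕ) → k ≤ ℓ → Matrix (Fin (n 0)) (Fin (n k)) ℝ
  | 0, _ => 0
  | k + 1, h => d2LayerProd W U V k (Nat.le_of_succ_le h) * weight W ⟨k, h⟩
      + dLayerProd W V k (Nat.le_of_succ_le h) * weight U ⟨k, h⟩
      + dLayerProd W U k (Nat.le_of_succ_le h) * weight V ⟨k, h⟩

/-- The product rule is kept entrywise, so no norm on matrices has to be chosen. -/
theorem hasDerivAt_mul_apply {a b c : ℕ} {A : ℝ → Matrix (Fin a) (Fin b) ℝ}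
    {B : ℝ → Matrix (Fin b) (Fin c) ℝ} {A' : Matrix (Fin a) (Fin b) ℝ}
    {B' : Matrix (Fin b) (Fin c) ℝ} {t : ℝ}
    (hA : ∀ i j, HasDerivAt (fun s => A s i j) (A' i j) t)
    (hB : ∀ i j, HasDerivAt (fun s => B s i j) (B' i j) t) (i : Fin a) (j : Fin c) :
    HasDerivAt (fun s => (A s * B s) i j) ((A' * B t + A t * B') i j) t := by
  simp only [Matrix.add_apply, Matrix.mul_apply, ← Finset.sum_add_distrib]
  exact HasDerivAt.fun_sum fun k _ => (hA i k).mul (hB k j)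

theorem hasDerivAt_weight (W U : Params ℓ n) (i : Fin ℓ) (t : ℝ) (a : Fin (n i))
    (b : Fin (n (i + 1))) :
    HasDerivAt (fun s : ℝ => weight (W + s • U) i a b) (weight U i a b) t := by
  simpa [weight] using ((hasDerivAt_id t).mul_const (U ⟨i, (a, b)⟩)).const_add (W ⟨i, (a, b)⟩)

theorem hasDerivAt_layerProd (W U : Params ℓ n) (t : ℝ) (k : ℕ) (h : k ≤ ℓ) (a : Fin (n 0))
    (b : Fin (n k)) :
    HasDerivAt (fun s : ℝ => layerProd (W + s • U) k h a b)
      (dLayerProd (W + t • U) U k h a b) t := by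
  induction k generalizing a with
  | zero => exact hasDerivAt_const _ _
  | succ k ih =>
    exact hasDerivAt_mul_apply (fun i j => ih (Nat.le_of_succ_le h) i j) (hasDerivAt_weight W U ⟨k, h⟩ t) a b

theorem hasDerivAt_dLayerProd (W U V : Params ℓ n) (t : ℝ) (k : ℕ) (h : k ≤ ℓ) (a : Fin (n 0))
    (b : Fin (n k)) :
    HasDerivAt (fun s : ℝ => dLayerProd (W + s • U) V k h a b)
      (d2LayerProd (W + t • U) U V k h a b) t := by
  induction k generalizing a with
  | zero => exact hasDerivAt_const _ _
  | succ k ih =>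
    have h1 := hasDerivAt_mul_apply (fun i j => ih (Nat.le_of_succ_le h) i j) (hasDerivAt_weight W U ⟨k, h⟩ t) a b
    have h2 := hasDerivAt_mul_apply (hasDerivAt_layerProd W U t k (Nat.le_of_succ_le h))
      (B := fun _ => weight V ⟨k, h⟩) (B' := 0) (fun _ _ => hasDerivAt_const _ _) a b
    rw [Matrix.mul_zero, add_zero] at h2
    exact h1.add h2

/-- The first derivative of `loss` at `W` in direction `U`. -/
def dLoss (Y : Matrix (Fin (n 0)) (Fin m) ℝ) (X : Matrix (Fin (n ℓ)) (Fin m) ℝ)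
    (W U : Params ℓ n) : ℝ :=
  -2 * ∑ i, ∑ j, (Y - layerProd W ℓ le_rfl * X) i j * (dLayerProd W U ℓ le_rfl * X) i j

/-- The second derivative of `loss` at `W` in directions `U` and `V`. -/
def d2Loss (Y : Matrix (Fin (n 0)) (Fin m) ℝ) (X : Matrix (Fin (n ℓ)) (Fin m) ℝ)
    (W U V : Params ℓ n) : ℝ :=
  2 * ∑ i, ∑ j, (dLayerProd W U ℓ le_rfl * X) i j * (dLayerProd W V ℓ le_rfl * X) i j
    - 2 * ∑ i, ∑ j, (Y - layerProd W ℓ le_rfl * X) i j * (d2LayerProd W U V ℓ le_rfl * X) i j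

variable (Y : Matrix (Fin (n 0)) (Fin m) ℝ) (X : Matrix (Fin (n ℓ)) (Fin m) ℝ)

theorem hasDerivAt_residual (W U : Params ℓ n) (t : ℝ) (i : Fin (n 0)) (j : Fin m) :
    HasDerivAt (fun s : ℝ => (Y - layerProd (W + s • U) ℓ le_rfl * X) i j)
      (-(dLayerProd (W + t • U) U ℓ le_rfl * X) i j) t := by
  have h := hasDerivAt_mul_apply (hasDerivAt_layerProd W U t ℓ le_rfl)
    (B := fun _ => X) (B' := 0) (fun _ _ => hasDerivAt_const _ _) i j
  rw [Matrix.mul_zero, add_zero] at h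
  exact h.const_sub (Y i j)

theorem hasDerivAt_loss (W U : Params ℓ n) (t : ℝ) :
    HasDerivAt (fun s : ℝ => loss Y X (W + s • U)) (dLoss Y X (W + t • U) U) t := by
  simp only [loss, frobNorm_sq]
  have h := HasDerivAt.fun_sum (u := Finset.univ) fun i _ =>
    HasDerivAt.fun_sum (u := Finset.univ) fun j _ => (hasDerivAt_residual Y X W U t i j).pow 2
  refine h.congr_deriv ?_
  simp only [dLoss, Finset.mul_sum]
  refine Finset.sum_congr rfl fun i _ => Finset.sum_congr rfl fun j _ => ?_
  push_cast
  ring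

theorem hasDerivAt_dLoss (W U V : Params ℓ n) (t : ℝ) :
    HasDerivAt (fun s : ℝ => dLoss Y X (W + s • U) V) (d2Loss Y X (W + t • U) U V) t := by
  have hV : ∀ i j, HasDerivAt (fun s : ℝ => (dLayerProd (W + s • U) V ℓ le_rfl * X) i j)
      ((d2LayerProd (W + t • U) U V ℓ le_rfl * X) i j) t := fun i j => by
    have h := hasDerivAt_mul_apply (hasDerivAt_dLayerProd W U V t ℓ le_rfl)
      (B := fun _ => X) (B' := 0) (fun _ _ => hasDerivAt_const _ _) i j
    rwa [Matrix.mul_zero, add_zero] at h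
  have h := (HasDerivAt.fun_sum (u := Finset.univ) fun i _ =>
    HasDerivAt.fun_sum (u := Finset.univ) fun j _ =>
      (hasDerivAt_residual Y X W U t i j).mul (hV i j)).const_mul (-2)
  refine h.congr_deriv ?_
  simp only [d2Loss, Finset.mul_sum, ← Finset.sum_sub_distrib]
  refine Finset.sum_congr rfl fun i _ => Finset.sum_congr rfl fun j _ => ?_
  ring

theorem contDiff_weight (i : Fin ℓ) (a : Fin (n i)) (b : Fin (n (i + 1))) :
    ContDiff ℝ 2 fun W : Params ℓ n => weight W i a b :=
  contDiff_euclidean.1 (contDiff_id (E := Params ℓ n)) ⟨i, (a, b)⟩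

theorem contDiff_layerProd (k : ℕ) (h : k ≤ ℓ) (a : Fin (n 0)) (b : Fin (n k)) :
    ContDiff ℝ 2 fun W : Params ℓ n => layerProd W k h a b := by
  induction k with
  | zero => exact contDiff_const
  | succ k ih =>
    simp only [layerProd, Matrix.mul_apply]
    exact ContDiff.sum fun j _ => (ih _ j).mul (contDiff_weight ⟨k, h⟩ j b)

theorem contDiff_loss : ContDiff ℝ 2 (loss Y X) := by
  have h : loss Y X = fun W => ∑ i, ∑ j, (Y - layerProd W ℓ le_rfl * X) i j ^ 2 :=
    funext fun W => frobNorm_sq _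
  rw [h]
  simp only [Matrix.sub_apply, Matrix.mul_apply]
  exact ContDiff.sum fun i _ => ContDiff.sum fun j _ => (contDiff_const.sub
    (ContDiff.sum fun k _ => (contDiff_layerProd ℓ le_rfl i k).mul contDiff_const)).pow 2

/-- A differentiable function whose restriction to the line through `w` in direction `u` has
derivative `d` satisfies `fderiv f w u = d`. -/
theorem fderiv_apply_of_hasDerivAt {E : Type*} [NormedAddCommGroup E] [NormedSpace ℝ E]
    {f : E → ℝ} {w u : E} {d : ℝ} (hf : DifferentiableAt ℝ f w)
    (h : HasDerivAt (fun s : ℝ => f (w + s • u)) d 0) : fderiv ℝ f w u = d :=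
  (hf.hasFDerivAt.hasLineDerivAt u).unique h

theorem fderiv_loss (W U : Params ℓ n) : fderiv ℝ (loss Y X) W U = dLoss Y X W U := by
  refine fderiv_apply_of_hasDerivAt ((contDiff_loss Y X).differentiable two_ne_zero W) ?_
  simpa using hasDerivAt_loss Y X W U 0

theorem differentiable_gradient {ι : Type} [Fintype ι] {f : EuclideanSpace ℝ ι → ℝ}
    (hf : ContDiff ℝ 2 f) : Differentiable ℝ (gradient f) := by
  classical
  intro w
  refine differentiableAt_euclidean.2 fun i => ?_
  have h : (fun x => gradient f x i) = fun x => fderiv ℝ f x (EuclideanSpace.single i 1) := by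
    funext x
    rw [← inner_gradient_left, EuclideanSpace.inner_single_right]
    simp
  rw [h]
  exact (((hf.fderiv_right (m := 1) le_rfl).differentiable one_ne_zero) w).clm_apply
    (differentiableAt_const _)

/-- Both sides are the derivative at s = 0 of ⟨∇f(W + sU), V⟩, which is `dLoss` at W + sU in
direction V. -/
theorem inner_hessian_loss (W U V : Params ℓ n) :
    inner ℝ (hessian (loss Y X) W U) V = d2Loss Y X W U V := by
  have hg := differentiable_gradient (contDiff_loss Y X) W
  have hl := hg.hasFDerivAt.hasLineDerivAt U
  have h1 : HasDerivAt (fun s : ℝ => inner ℝ (gradient (loss Y X) (W + s • U)) V)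
      (inner ℝ (hessian (loss Y X) W U) V) 0 := by
    simpa [hessian] using! HasDerivAt.inner ℝ hl (hasDerivAt_const (0 : ℝ) V)
  simp only [inner_gradient_left, fderiv_loss] at h1
  refine h1.unique ?_
  simpa using hasDerivAt_dLoss Y X W U V 0

end Derivatives

/-! ### Norm bounds for the derivatives, balanced weights, and comparison with the constants. -/

section Bounds

variable {ℓ m : ℕ} {n : ℕ → ℕ}

/-- The Frobenius norm of layer `i`, or `0` if there is no such layer. -/
def layerNorm (U : Params ℓ n) (i : ℕ) : ℝ :=
  if h : i < ℓ then frobNorm (weight U ⟨i, h⟩) else 0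

theorem layerNorm_nonneg (U : Params ℓ n) (i : ℕ) : 0 ≤ layerNorm U i := by
  unfold layerNorm
  split_ifs
  exacts [frobNorm_nonneg _, le_rfl]

theorem frobNorm_weight (U : Params ℓ n) {i : ℕ} (h : i < ℓ) :
    frobNorm (weight U ⟨i, h⟩) = layerNorm U i := by
  rw [layerNorm, dif_pos h]

theorem sum_layerNorm_nonneg (U : Params ℓ n) (k : ℕ) :
    0 ≤ ∑ i ∈ Finset.range k, layerNorm U i :=
  Finset.sum_nonneg fun i _ => layerNorm_nonneg U i

theorem sum_frobNorm_weight_sq (U : Params ℓ n) :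
    ∑ i, frobNorm (weight U i) ^ 2 = ‖U‖ ^ 2 := by
  rw [EuclideanSpace.norm_sq_eq, Fintype.sum_sigma]
  simp [frobNorm_sq, weight, Fintype.sum_prod_type]

theorem sum_layerNorm_le (U : Params ℓ n) :
    ∑ i ∈ Finset.range ℓ, layerNorm U i ≤ √ℓ * ‖U‖ := by
  refine (sq_le_sq₀ (sum_layerNorm_nonneg U ℓ) (by positivity)).mp ?_
  rw [mul_pow, Real.sq_sqrt (Nat.cast_nonneg _), ← sum_frobNorm_weight_sq, Finset.sum_range]
  simp only [← frobNorm_weight U (Fin.is_lt _), Fin.eta]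
  simpa using sq_sum_le_card_mul_sum_sq (s := Finset.univ) (f := fun i => frobNorm (weight U i))

variable {W : Params ℓ n} {s : ℝ}

theorem specNorm_layerProd_le (hs : 0 ≤ s) (hW : ∀ i, specNorm (weight W i) ≤ s) (k : ℕ)
    (h : k ≤ ℓ) : specNorm (layerProd W k h) ≤ s ^ k := by
  induction k with
  | zero => simpa [layerProd] using specNorm_one_le
  | succ k ih =>
    rw [pow_succ]
    exact (specNorm_mul_le _ _).trans
      (mul_le_mul (ih _) (hW _) (specNorm_nonneg _) (pow_nonneg hs k))

theorem frobNorm_dLayerProd_le (hs : 0 ≤ s) (hW : ∀ i, specNorm (weight W i) ≤ s)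
    (U : Params ℓ n) (k : ℕ) (h : k + 1 ≤ ℓ) :
    frobNorm (dLayerProd W U (k + 1) h) ≤ s ^ k * ∑ i ∈ Finset.range (k + 1), layerNorm U i := by
  have hstep : ∀ (k : ℕ) (h : k + 1 ≤ ℓ), frobNorm (dLayerProd W U (k + 1) h)
      ≤ frobNorm (dLayerProd W U k (Nat.le_of_succ_le h)) * s + s ^ k * layerNorm U k := by
    intro k h
    refine (frobNorm_add_le _ _).trans (add_le_add ?_ ?_)
    · exact (frobNorm_mul_le' _ _).trans
        (mul_le_mul_of_nonneg_left (hW _) (frobNorm_nonneg _))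
    · rw [← frobNorm_weight U h]
      exact (frobNorm_mul_le _ _).trans (mul_le_mul_of_nonneg_right
        (specNorm_layerProd_le hs hW k _) (frobNorm_nonneg _))
  induction k with
  | zero => simpa [dLayerProd, frobNorm_zero] using hstep 0 h
  | succ k ih =>
    refine (hstep (k + 1) h).trans ?_
    rw [Finset.sum_range_succ _ (k + 1)]
    exact (add_le_add_left (mul_le_mul_of_nonneg_right (ih _) hs) _).trans_eq (by ring)

theorem frobNorm_d2LayerProd_le (hs : 0 ≤ s) (hW : ∀ i, specNorm (weight W i) ≤ s)
    (U V : Params ℓ n) (k : ℕ) (h : k + 2 ≤ ℓ) :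
    frobNorm (d2LayerProd W U V (k + 2) h) ≤
      s ^ k * ((∑ i ∈ Finset.range (k + 2), layerNorm U i) *
        ∑ i ∈ Finset.range (k + 2), layerNorm V i) := by
  have hstep : ∀ (k : ℕ) (h : k + 2 ≤ ℓ), frobNorm (d2LayerProd W U V (k + 2) h)
      ≤ frobNorm (d2LayerProd W U V (k + 1) (Nat.le_of_succ_le h)) * s
        + s ^ k * ((∑ i ∈ Finset.range (k + 1), layerNorm V i) * layerNorm U (k + 1))
        + s ^ k * ((∑ i ∈ Finset.range (k + 1), layerNorm U i) * layerNorm V (k + 1)) := by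
    intro k h
    have hmix : ∀ U V : Params ℓ n,
        frobNorm (dLayerProd W U (k + 1) (Nat.le_of_succ_le h) * weight V ⟨k + 1, h⟩)
          ≤ s ^ k * ((∑ i ∈ Finset.range (k + 1), layerNorm U i) * layerNorm V (k + 1)) := by
      intro U V
      rw [← frobNorm_weight V h, ← mul_assoc]
      exact (frobNorm_mul_le' _ _).trans (mul_le_mul (frobNorm_dLayerProd_le hs hW U k _)
        (specNorm_le_frobNorm _) (specNorm_nonneg _)
        (mul_nonneg (pow_nonneg hs k) (sum_layerNorm_nonneg U _)))
    refine (frobNorm_add_le _ _).trans (add_le_add ((frobNorm_add_le _ _).trans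
      (add_le_add ?_ (hmix V U))) (hmix U V))
    exact (frobNorm_mul_le' _ _).trans (mul_le_mul_of_nonneg_left (hW _) (frobNorm_nonneg _))
  -- The product of the two longer sums also contains the term with both directions in layer k + 1;
  -- it is nonnegative and is dropped.
  have hfin : ∀ k : ℕ,
      s ^ k * ((∑ i ∈ Finset.range (k + 1), layerNorm U i) *
          ∑ i ∈ Finset.range (k + 1), layerNorm V i)
        + s ^ k * ((∑ i ∈ Finset.range (k + 1), layerNorm V i) * layerNorm U (k + 1))
        + s ^ k * ((∑ i ∈ Finset.range (k + 1), layerNorm U i) * layerNorm V (k + 1))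
      ≤ s ^ k * ((∑ i ∈ Finset.range (k + 2), layerNorm U i) *
        ∑ i ∈ Finset.range (k + 2), layerNorm V i) := by
    intro k
    rw [Finset.sum_range_succ _ (k + 1), Finset.sum_range_succ _ (k + 1), ← mul_add, ← mul_add]
    refine mul_le_mul_of_nonneg_left ?_ (pow_nonneg hs k)
    linarith [mul_nonneg (layerNorm_nonneg U (k + 1)) (layerNorm_nonneg V (k + 1))]
  induction k with
  | zero =>
    refine (hstep 0 h).trans (le_trans ?_ (hfin 0))
    refine add_le_add_left (add_le_add_left ?_ _) _
    simpa [d2LayerProd, dLayerProd, frobNorm_zero] using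
      mul_nonneg (layerNorm_nonneg U 0) (layerNorm_nonneg V 0)
  | succ k ih =>
    refine (hstep (k + 1) h).trans (le_trans ?_ (hfin (k + 1)))
    refine add_le_add_left (add_le_add_left ?_ _) _
    rw [pow_succ, mul_right_comm]
    exact mul_le_mul_of_nonneg_right (ih _) hs

/-- For consecutive layers, ‖W_i‖² = ‖W_iᵀW_i‖ = ‖W_{i+1}W_{i+1}ᵀ‖ = ‖W_{i+1}‖². -/
theorem StronglyBalanced.specNorm_weight_eq (hW : StronglyBalanced W) {i j : ℕ} (hi : i < ℓ)
    (hj : j < ℓ) : specNorm (weight W ⟨i, hi⟩) = specNorm (weight W ⟨j, hj⟩) := by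
  have h0 : ∀ (i : ℕ) (hi : i < ℓ),
      specNorm (weight W ⟨i, hi⟩) = specNorm (weight W ⟨0, i.zero_le.trans_lt hi⟩) := by
    intro i
    induction i with
    | zero => exact fun _ => rfl
    | succ i ih =>
      intro hi
      rw [← ih (Nat.lt_of_succ_lt hi)]
      refine (sq_eq_sq₀ (specNorm_nonneg _) (specNorm_nonneg _)).1 ?_
      rw [← specNorm_transpose_mul_self (weight W ⟨i, _⟩), hW i hi,
        ← specNorm_transpose (weight W ⟨i + 1, hi⟩), ← specNorm_transpose_mul_self,
        Matrix.transpose_transpose]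
  rw [h0 i hi, h0 j hj]

/-- With A the next layer, balancedness turns the inner Gram power into (AAᵀ)^(k+1), and Aᵀ(AAᵀ)^j A
= (AᵀA)^(j+1). -/
theorem StronglyBalanced.layerProd_gram (hW : StronglyBalanced W) (k : ℕ) (h : k + 1 ≤ ℓ) :
    (layerProd W (k + 1) h)ᵀ * layerProd W (k + 1) h =
      ((weight W ⟨k, h⟩)ᵀ * weight W ⟨k, h⟩) ^ (k + 1) := by
  induction k with
  | zero => simp [layerProd]
  | succ k ih =>
    set A := weight W ⟨k + 1, h⟩ with hA
    change (layerProd W (k + 1) _ * A)ᵀ * (layerProd W (k + 1) _ * A) = _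
    have hpow : ∀ j : ℕ, Aᵀ * (A * Aᵀ) ^ j * A = (Aᵀ * A) ^ (j + 1) := by
      intro j
      induction j with
      | zero => simp
      | succ j ihj => rw [pow_succ (Aᵀ * A), ← ihj, pow_succ]; simp only [Matrix.mul_assoc]
    rw [Matrix.transpose_mul, Matrix.mul_assoc, ← Matrix.mul_assoc _ _ A, ih, hW k h, ← hA,
      ← Matrix.mul_assoc, hpow]

theorem StronglyBalanced.pow_le_specNorm_layerProd (hW : StronglyBalanced W) (k : ℕ)
    (h : k + 1 ≤ ℓ) :
    specNorm (weight W ⟨k, h⟩) ^ (k + 1) ≤ specNorm (layerProd W (k + 1) h) := by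
  refine (sq_le_sq₀ (pow_nonneg (specNorm_nonneg _) _) (specNorm_nonneg _)).mp ?_
  rw [← specNorm_transpose_mul_self, hW.layerProd_gram, pow_right_comm,
    ← specNorm_transpose_mul_self]
  exact pow_specNorm_le_specNorm_pow (by simp) k

/-- The factor ℓ comes from Cauchy–Schwarz over the layers, √ℓ for each direction. For ℓ = 1 the
product is linear, so its second derivative vanishes; the `if` records this, as the truncated
exponent ℓ − 2 would give s^0 = 1. -/
theorem norm_hessian_loss_le (Y : Matrix (Fin (n 0)) (Fin m) ℝ)
    (X : Matrix (Fin (n ℓ)) (Fin m) ℝ) (hs : 0 ≤ s) (hW : ∀ i, specNorm (weight W i) ≤ s)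
    (hℓ : 1 ≤ ℓ) :
    ‖hessian (loss Y X) W‖ ≤ 2 * ℓ * (s ^ (2 * (ℓ - 1)) * specNorm X ^ 2
      + (if ℓ = 1 then 0 else s ^ (ℓ - 2)) * specNorm X * √(loss Y X W)) := by
  set T : ℝ := if ℓ = 1 then 0 else s ^ (ℓ - 2) with hT
  have hT0 : 0 ≤ T := by rw [hT]; positivity
  set x := specNorm X
  have hx : 0 ≤ x := specNorm_nonneg X
  have hg : frobNorm (Y - layerProd W ℓ le_rfl * X) = √(loss Y X W) :=
    (Real.sqrt_sq (frobNorm_nonneg _)).symm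
  have h1 : ∀ U : Params ℓ n,
      frobNorm (dLayerProd W U ℓ le_rfl * X) ≤ s ^ (ℓ - 1) * (√ℓ * ‖U‖) * x := by
    intro U
    refine (frobNorm_mul_le' _ _).trans (mul_le_mul_of_nonneg_right ?_ hx)
    refine le_trans ?_ (mul_le_mul_of_nonneg_left (sum_layerNorm_le U) (pow_nonneg hs _))
    obtain ⟨k, rfl⟩ := Nat.exists_eq_add_of_le' hℓ
    exact frobNorm_dLayerProd_le hs hW U k le_rfl
  have h2 : ∀ U V : Params ℓ n, frobNorm (d2LayerProd W U V ℓ le_rfl * X)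
      ≤ T * (√ℓ * ‖U‖ * (√ℓ * ‖V‖)) * x := by
    intro U V
    refine (frobNorm_mul_le' _ _).trans (mul_le_mul_of_nonneg_right ?_ hx)
    refine le_trans ?_ (mul_le_mul_of_nonneg_left (mul_le_mul (sum_layerNorm_le U)
      (sum_layerNorm_le V) (sum_layerNorm_nonneg V ℓ) (by positivity)) hT0)
    obtain ⟨k, rfl⟩ := Nat.exists_eq_add_of_le' hℓ
    cases k with
    | zero => simp [hT, d2LayerProd, dLayerProd, frobNorm_zero]
    | succ k => simpa [hT] using frobNorm_d2LayerProd_le hs hW U V k le_rfl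
  have hl : √(ℓ : ℝ) * √(ℓ : ℝ) = ℓ := Real.mul_self_sqrt (Nat.cast_nonneg _)
  have hform : ∀ U V : Params ℓ n, |d2Loss Y X W U V| ≤
      2 * ℓ * (s ^ (2 * (ℓ - 1)) * x ^ 2 + T * x * √(loss Y X W)) * ‖U‖ * ‖V‖ := by
    intro U V
    have e1 := (abs_sum_mul_le_frobNorm (dLayerProd W U ℓ le_rfl * X)
      (dLayerProd W V ℓ le_rfl * X)).trans
      (mul_le_mul (h1 U) (h1 V) (frobNorm_nonneg _) (by positivity))
    have e2 := (abs_sum_mul_le_frobNorm (Y - layerProd W ℓ le_rfl * X)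
      (d2LayerProd W U V ℓ le_rfl * X)).trans
      (mul_le_mul_of_nonneg_left (h2 U V) (frobNorm_nonneg _))
    rw [hg] at e2
    refine (abs_sub _ _).trans ?_
    rw [abs_mul, abs_mul, abs_two]
    refine (add_le_add (mul_le_mul_of_nonneg_left e1 zero_le_two)
      (mul_le_mul_of_nonneg_left e2 zero_le_two)).trans_eq ?_
    rw [two_mul (ℓ - 1), pow_add]
    linear_combination
      (2 * (s ^ (ℓ - 1) * s ^ (ℓ - 1) * x ^ 2 + T * x * √(loss Y X W)) * ‖U‖ * ‖V‖) * hl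
  refine ContinuousLinearMap.opNorm_le_bound _ (by positivity) fun U => ?_
  set H := hessian (loss Y X) W
  rcases (norm_nonneg (H U)).eq_or_lt with h0 | h0
  · rw [← h0]; positivity
  -- The form bound is tested on V = HU, and one factor ‖HU‖ cancels.
  refine le_of_mul_le_mul_right ?_ h0
  rw [← real_inner_self_eq_norm_mul_norm, inner_hessian_loss]
  exact (le_abs_self _).trans (hform U (H U))

theorem rpow_le_one_add_sq {g e : ℝ} (hg : 0 ≤ g) (he : 0 ≤ e) (he2 : e ≤ 2) :
    g ^ e ≤ 1 + g ^ 2 := by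
  rcases le_total g 1 with h | h
  · exact (Real.rpow_le_one hg h he).trans (le_add_of_nonneg_right (sq_nonneg g))
  · refine (Real.rpow_le_rpow_of_exponent_le h he2).trans ?_
    rw [Real.rpow_two]
    linarith

/-- If `s ^ ℓ` is at most `(y + g) / √lam`, then the smaller powers of `s` are controlled by
powers of `y` and `g`. -/
theorem pow_le_of_pow_mul_sqrt_le {lam κ y g : ℝ} (hs : 0 ≤ s) (hℓ : 1 ≤ ℓ) (hlam : 0 < lam)
    (hκ : 2 ≤ κ) (hy : 0 ≤ y) (hg : 0 ≤ g) (h : √lam * s ^ ℓ ≤ y + g) (j : ℕ) :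
    s ^ j ≤ κ ^ ((j : ℝ) / ℓ) * (1 / lam) ^ ((j : ℝ) / (2 * ℓ)) *
      (y ^ ((j : ℝ) / ℓ) + g ^ ((j : ℝ) / ℓ)) := by
  have hℓ0 : (ℓ : ℝ) ≠ 0 := by positivity
  have hsq : 0 < √lam := Real.sqrt_pos.2 hlam
  set e : ℝ := (j : ℝ) / ℓ with he
  have he0 : 0 ≤ e := by positivity
  have hsj : s ^ j = (s ^ ℓ) ^ e := by
    rw [← Real.rpow_natCast, ← Real.rpow_natCast, ← Real.rpow_mul hs, he, mul_div_cancel₀ _ hℓ0]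
  -- The 2 in κ absorbs y + g ≤ 2 max(y, g). Using the maximum lets the real power pass to y or g
  -- without a further constant.
  have hsl : s ^ ℓ ≤ κ * (1 / lam) ^ (1 / 2 : ℝ) * max y g := by
    have h2 : √lam * s ^ ℓ ≤ κ * max y g := by
      nlinarith [le_max_left y g, le_max_right y g]
    rw [← Real.sqrt_eq_rpow, Real.sqrt_div zero_le_one, Real.sqrt_one]
    rw [mul_comm, ← le_div_iff₀ hsq] at h2
    refine h2.trans_eq ?_
    ring
  rw [hsj]
  refine (Real.rpow_le_rpow (pow_nonneg hs _) hsl he0).trans ?_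
  rw [Real.mul_rpow (by positivity) (by positivity), Real.mul_rpow (by positivity) (by positivity),
    ← Real.rpow_mul (by positivity), show 1 / 2 * e = (j : ℝ) / (2 * ℓ) by rw [he]; field_simp]
  refine mul_le_mul_of_nonneg_left ?_ (by positivity)
  have hy' := Real.rpow_nonneg hy e
  have hg' := Real.rpow_nonneg hg e
  rcases max_choice y g with h | h <;> rw [h] <;> linarith

/-- The powers of g have exponents (2ℓ−2)/ℓ and, for ℓ ≥ 2, (ℓ−2)/ℓ + 1 and 1, all in [0, 2]. The
factor in d serves only through κ ≥ 2, and 2ℓ ≤ 4ℓ² leaves further slack. -/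
theorem hessian_bound_le_const {lam x y g : ℝ} {d : ℕ} (hs : 0 ≤ s) (hℓ : 1 ≤ ℓ)
    (hlam : 0 < lam) (hd : 1 ≤ d) (hx : 0 ≤ x) (hy : 0 ≤ y) (hg : 0 ≤ g)
    (h : √lam * s ^ ℓ ≤ y + g) :
    2 * ℓ * (s ^ (2 * (ℓ - 1)) * x ^ 2 + (if ℓ = 1 then 0 else s ^ (ℓ - 2)) * x * g) ≤
      2 * constH0bar ℓ d lam x y + constH1 ℓ d lam x y * (1 + g ^ 2) := by
  have hℓ1 : (1 : ℝ) ≤ ℓ := by exact_mod_cast hℓ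
  unfold constH0bar constH1
  set κ : ℝ := 2 * (d : ℝ) ^ (((ℓ : ℝ) - 1) / 2)
  have hκ : 2 ≤ κ := le_mul_of_one_le_right zero_le_two
    (Real.one_le_rpow (by exact_mod_cast hd) (by linarith))
  set A : ℝ := κ ^ ((2 * (ℓ : ℝ) - 2) / ℓ) * (1 / lam) ^ ((2 * (ℓ : ℝ) - 2) / (2 * ℓ)) with hA
  set B : ℝ := κ ^ (((ℓ : ℝ) - 2) / ℓ) * (1 / lam) ^ (((ℓ : ℝ) - 2) / (2 * ℓ)) with hB
  set p : ℝ := y ^ ((2 * (ℓ : ℝ) - 2) / ℓ) with hp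
  set q : ℝ := y ^ (((ℓ : ℝ) - 2) / ℓ) with hq
  have hA0 : 0 ≤ A := by positivity
  have hB0 : 0 ≤ B := by positivity
  have hp0 : 0 ≤ p := by positivity
  have hq0 : 0 ≤ q := by positivity
  have h1 : s ^ (2 * (ℓ - 1)) ≤ A * (p + (1 + g ^ 2)) := by
    have hj := pow_le_of_pow_mul_sqrt_le hs hℓ hlam hκ hy hg h (2 * (ℓ - 1))
    have hcast : ((2 * (ℓ - 1) : ℕ) : ℝ) = 2 * (ℓ : ℝ) - 2 := by
      push_cast [Nat.cast_sub hℓ]; ring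
    rw [hcast] at hj
    refine hj.trans (mul_le_mul_of_nonneg_left (add_le_add_right ?_ _) hA0)
    refine rpow_le_one_add_sq hg (div_nonneg (by linarith) (by linarith)) ?_
    rw [div_le_iff₀ (by linarith)]
    linarith
  have h2 : (if ℓ = 1 then 0 else s ^ (ℓ - 2)) * g ≤ B * (q * (1 + g ^ 2) + (1 + g ^ 2)) := by
    split_ifs with hl
    -- For ℓ = 1 the exponent of y in q is −1; only q ≥ 0 matters, and this holds at y = 0 too.
    · rw [zero_mul]; positivity
    have hℓ2 : 2 ≤ ℓ := by omega
    have hℓ2' : (2 : ℝ) ≤ ℓ := by exact_mod_cast hℓ2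
    have hj := pow_le_of_pow_mul_sqrt_le hs hℓ hlam hκ hy hg h (ℓ - 2)
    rw [show ((ℓ - 2 : ℕ) : ℝ) = (ℓ : ℝ) - 2 by push_cast [Nat.cast_sub hℓ2]; ring] at hj
    refine (mul_le_mul_of_nonneg_right hj hg).trans ?_
    rw [mul_assoc, add_mul]
    have he0 : 0 ≤ ((ℓ : ℝ) - 2) / ℓ := div_nonneg (by linarith) (by linarith)
    have he1 : ((ℓ : ℝ) - 2) / ℓ ≤ 1 := by
      rw [div_le_iff₀ (by linarith)]
      linarith
    refine mul_le_mul_of_nonneg_left (add_le_add ?_ ?_) hB0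
    · exact mul_le_mul_of_nonneg_left (by nlinarith [sq_nonneg (g - 1)]) hq0
    · have hr : g ^ (((ℓ : ℝ) - 2) / ℓ) * g = g ^ (((ℓ : ℝ) - 2) / ℓ + 1) := by
        rw [Real.rpow_add_of_nonneg hg he0 zero_le_one, Real.rpow_one]
      rw [hr]
      exact rpow_le_one_add_sq hg (by linarith) (by linarith)
  have hmain : s ^ (2 * (ℓ - 1)) * x ^ 2 + (if ℓ = 1 then 0 else s ^ (ℓ - 2)) * x * g ≤
      2 * (A * p * x ^ 2 + B * q * x) + (A * x ^ 2 + B * x + B * q * x) * (1 + g ^ 2) := by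
    have e1 := mul_le_mul_of_nonneg_right h1 (sq_nonneg x)
    have e2 := mul_le_mul_of_nonneg_right h2 hx
    have p1 : 0 ≤ A * p * x ^ 2 := by positivity
    have p2 : 0 ≤ B * q * x := by positivity
    linarith
  have hN : 0 ≤ 2 * (A * p * x ^ 2 + B * q * x)
      + (A * x ^ 2 + B * x + B * q * x) * (1 + g ^ 2) := by positivity
  have hc : 2 * (ℓ : ℝ) ≤ 4 * (ℓ : ℝ) ^ 2 := by nlinarith
  refine ((mul_le_mul_of_nonneg_left hmain (by positivity)).trans
    (mul_le_mul_of_nonneg_right hc hN)).trans_eq ?_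
  ring

end Bounds

end DeepLinear

end

theorem mainTheorem6 (ℓ m : ℕ) (hℓ : 1 ≤ ℓ) (n : ℕ → ℕ)
    (Y : Matrix (Fin (n 0)) (Fin m) ℝ) (X : Matrix (Fin (n ℓ)) (Fin m) ℝ)
    (hX : 0 < DeepLinear.lambdaMinGram X)
    (fstar : ℝ)
    (hfstar : fstar = ⨅ V : DeepLinear.Params ℓ n, DeepLinear.loss Y X V)
    (W : DeepLinear.Params ℓ n) (hW : DeepLinear.StronglyBalanced W) :
    ‖DeepLinear.hessian (DeepLinear.loss Y X) W‖ ≤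
      DeepLinear.constH0 ℓ (n ℓ) (DeepLinear.lambdaMinGram X) (DeepLinear.specNorm X)
          (DeepLinear.frobNorm Y) fstar
        + DeepLinear.constH1 ℓ (n ℓ) (DeepLinear.lambdaMinGram X) (DeepLinear.specNorm X)
            (DeepLinear.frobNorm Y) * (DeepLinear.loss Y X W - fstar) := by
  open DeepLinear in
  have hd : 1 ≤ n ℓ := by
    by_contra h0
    have : IsEmpty (Fin (n ℓ)) := by
      rw [show n ℓ = 0 by omega]
      infer_instance
    -- An infimum over no eigenvalues is 0 by convention, which contradicts positivity.
    rw [lambdaMinGram, Real.iInf_of_isEmpty] at hX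
    exact hX.false
  have hlast : ℓ - 1 < ℓ := by omega
  set s := specNorm (weight W ⟨ℓ - 1, hlast⟩)
  have hs : 0 ≤ s := specNorm_nonneg _
  have hWs : ∀ i, specNorm (weight W i) ≤ s := fun i => (hW.specNorm_weight_eq i.2 hlast).le
  have hsP : s ^ ℓ ≤ specNorm (layerProd W ℓ le_rfl) := by
    obtain ⟨k, rfl⟩ := Nat.exists_eq_add_of_le' hℓ
    exact hW.pow_le_specNorm_layerProd k le_rfl
  have hloss : √(loss Y X W) = frobNorm (Y - layerProd W ℓ le_rfl * X) :=
    Real.sqrt_sq (frobNorm_nonneg _)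
  have hgrow : √(lambdaMinGram X) * s ^ ℓ ≤ frobNorm Y + √(loss Y X W) := by
    have h := frobNorm_sub_le Y (Y - layerProd W ℓ le_rfl * X)
    rw [sub_sub_cancel] at h
    rw [hloss]
    exact ((mul_le_mul_of_nonneg_left (hsP.trans (specNorm_le_frobNorm _))
      (Real.sqrt_nonneg _)).trans (sqrt_lambdaMinGram_mul_frobNorm_le _ X)).trans h
  refine (norm_hessian_loss_le Y X hs hWs hℓ).trans ((hessian_bound_le_const hs hℓ hX hd
    (specNorm_nonneg X) (frobNorm_nonneg Y) (Real.sqrt_nonneg _) hgrow).trans_eq ?_)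
  -- Here g² = f(W), and f* cancels: H₀ + H₁(f(W) − f*) = 2H̄₀ + H₁(1 + f(W)).
  rw [Real.sq_sqrt (show 0 ≤ loss Y X W from sq_nonneg _), constH0]
  ring
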